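/- Let $\Gamma$ be a finite simplicial graph (undirected, without loops or multiple edges) with vertex set $V$, and let $N : V \to \{1,2,3,\dots\}$. Let $G = \mathrm{NGP}(\Gamma,N)$ be the group with generators $V$ and relations $v^{N(v)} = 1$ for $v \in V$ and $uv = vu$ for every edge $\{u,v\}$ of $\Gamma$, and let $S = V \cup V^{-1} \subseteq G$ be its standard generating set, viewed as a set of elements of $G$ (so $v$ and $v^{-1}$ are the same letter if $N(v) = 2$). The geodesic language of $(G,S)$ is the set of words $x \in S^*$ such that no shorter word in $S^*$ evaluates to the same element of $G$ as $x$. Let $\mathrm{Lk}(v)$ denote the set of neighbours of $v$ in $\Gamma$. A powered clique of $(\Gamma,N)$ is a map $\Sigma : V \to \mathbb{Z}$ whose support $\mathrm{supp}(\Sigma) = \{v : \Sigma(v) \neq 0\}$ is a clique of $\Gamma$ (the empty set being a clique) and which satisfies $0 \leq \Sigma(v) \leq 1$ if $N(v) = 2$ and $-\lfloor N(v)/2 \rfloor \leq \Sigma(v) \leq \lfloor N(v)/2 \rfloor$ if $N(v) \neq 2$, for every $v \in V$. Then there is a unique deterministic finite state automaton $\mathcal{D}$ over the alphabet $S$ with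 the following properties, and the language accepted by $\mathcal{D}$ is the geodesic language of $(G,S)$. - The states of $\mathcal{D}$ are the powered cliques of $(\Gamma,N)$ and one further state $q_{\mathrm{rej}}$. The accept states are exactly the powered cliques, and the start state is the powered clique with empty support. - If $\Sigma$ is a powered clique and $v \in V$ satisfies $0 \leq \Sigma(v) < \lfloor N(v)/2 \rfloor$, then $\delta(\Sigma, v)$ is the powered clique with support $(\mathrm{supp}(\Sigma) \cap \mathrm{Lk}(v)) \cup \{v\}$ and powers $\delta(\Sigma,v)(u) = \Sigma(u)$ for $u \in \mathrm{Lk}(v)$ and $\delta(\Sigma,v)(v) = \Sigma(v) + 1$. - If $\Sigma$ is a powered clique and $v \in V$ satisfies $N(v) \neq 2$ and $-\lfloor N(v)/2 \rfloor < \Sigma(v) \leq 0$, then $\delta(\Sigma, v^{-1})$ is the powered clique with support $(\mathrm{supp}(\Sigma) \cap \mathrm{Lk}(v)) \cup \{v\}$ and powers $\delta(\Sigma,v^{-1})(u) = \Sigma(u)$ for $u \in \mathrm{Lk}(v)$ and $\delta(\Sigma,v^{-1})(v) = \Sigma(v) - 1$. - In all other cases the transition leads to $q_{\mathrm{rej}}$: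 that is, $\delta(\Sigma,v) = q_{\mathrm{rej}}$ if $\Sigma(v) < 0$ or $\Sigma(v) \geq \lfloor N(v)/2 \rfloor$; $\delta(\Sigma,v^{-1}) = q_{\mathrm{rej}}$ if $N(v) \neq 2$ and either $\Sigma(v) > 0$ or $\Sigma(v) = -\lfloor N(v)/2 \rfloor$; and $\delta(q_{\mathrm{rej}}, s) = q_{\mathrm{rej}}$ for every $s \in S$. -/

import Mathlib

/-- The geodesic language of a group `G` with respect to a set `S` of letters: the words
`x` over `S` such that no shorter word over `S` evaluates to the same element of `G`. -/
def geodesicLanguage {G : Type*} [Group G] (S : Set G) : Language ↥S :=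
  {x : List ↥S | ∀ y : List ↥S,
    (y.map Subtype.val).prod = (x.map Subtype.val).prod → x.length ≤ y.length}

/-- The defining relators of the numbered graph product: `v ^ N v` for every vertex `v`, and the
commutator of `u` and `v` for every edge `{u, v}`. -/
def ngpRels {V : Type*} (Γ : SimpleGraph V) (N : V → ℕ) : Set (FreeGroup V) :=
  {r | ∃ v, r = FreeGroup.of v ^ N v} ∪
    {r | ∃ u v, Γ.Adj u v ∧
      r = FreeGroup.of u * FreeGroup.of v * (FreeGroup.of u)⁻¹ * (FreeGroup.of v)⁻¹}

/-- The numbered graph product of `(Γ, N)`. -/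
abbrev NGP {V : Type*} (Γ : SimpleGraph V) (N : V → ℕ) : Type _ :=
  PresentedGroup (ngpRels Γ N)

/-- The element of the numbered graph product given by a vertex. -/
def ngpGen {V : Type*} (Γ : SimpleGraph V) (N : V → ℕ) (v : V) : NGP Γ N :=
  PresentedGroup.of v

/-- The standard generating set `V ∪ V⁻¹`, as a subset of the group; in particular `v` and `v⁻¹`
are one and the same letter when `N v = 2`. -/
def ngpStdGens {V : Type*} (Γ : SimpleGraph V) (N : V → ℕ) : Set (NGP Γ N) :=
  Set.range (ngpGen Γ N) ∪ Set.range fun v => (ngpGen Γ N v)⁻¹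

/-- The letter `v`. -/
def posLetter {V : Type*} (Γ : SimpleGraph V) (N : V → ℕ) (v : V) : ↥(ngpStdGens Γ N) :=
  ⟨ngpGen Γ N v, Or.inl ⟨v, rfl⟩⟩

/-- The letter `v⁻¹`. -/
def negLetter {V : Type*} (Γ : SimpleGraph V) (N : V → ℕ) (v : V) : ↥(ngpStdGens Γ N) :=
  ⟨(ngpGen Γ N v)⁻¹, Or.inr ⟨v, rfl⟩⟩

/-- Powered cliques of the numbered graph `(Γ, N)`. Here `N v / 2` is the division of natural
numbers, that is, the floor of one half of `N v`. -/
@[ext]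
structure PoweredClique {V : Type*} (Γ : SimpleGraph V) (N : V → ℕ) where
  /-- the power at each vertex -/
  power : V → ℤ
  isClique_support : Γ.IsClique {v | power v ≠ 0}
  bounds_of_eq_two : ∀ v, N v = 2 → 0 ≤ power v ∧ power v ≤ 1
  bounds_of_ne_two : ∀ v, N v ≠ 2 →
    -((N v / 2 : ℕ) : ℤ) ≤ power v ∧ power v ≤ ((N v / 2 : ℕ) : ℤ)

namespace PoweredClique

/-- The support of a powered clique. -/
def supp {V : Type*} {Γ : SimpleGraph V} {N : V → ℕ} (P : PoweredClique Γ N) : Set V :=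
  {v | P.power v ≠ 0}

/-- The empty powered clique. -/
def empty {V : Type*} (Γ : SimpleGraph V) (N : V → ℕ) : PoweredClique Γ N where
  power := fun _ => 0
  isClique_support := by intro u hu; exact absurd rfl hu
  bounds_of_eq_two := by intro v _; constructor <;> norm_num
  bounds_of_ne_two := by intro v _; constructor <;> omega

/-- `P.IsMove v k P'` says that `P'` is the powered clique with support
`(supp P ∩ Lk v) ∪ {v}`, with the powers of `P` on `Lk v`, and with power `k` at `v`.
The link of `v` is its set of neighbours. -/
structure IsMove {V : Type*} {Γ : SimpleGraph V} {N : V → ℕ}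
    (P : PoweredClique Γ N) (v : V) (k : ℤ) (P' : PoweredClique Γ N) : Prop where
  supp_eq : P'.supp = (P.supp ∩ Γ.neighborSet v) ∪ {v}
  power_of_mem_link : ∀ u ∈ Γ.neighborSet v, P'.power u = P.power u
  power_self : P'.power v = k

end PoweredClique

/-- The description of the automaton. Its states are the powered cliques, `some P`, together with
one further state `none`, the reject state. -/
structure IsPoweredCliqueAutomaton {V : Type*} (Γ : SimpleGraph V) (N : V → ℕ)
    (D : DFA ↥(ngpStdGens Γ N) (Option (PoweredClique Γ N))) : Prop where
  start_eq : D.start = some (PoweredClique.empty Γ N)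
  accept_eq : D.accept = Set.range some
  /-- a transition along `v` that raises the power at `v` -/
  step_pos : ∀ (P : PoweredClique Γ N) (v : V),
    0 ≤ P.power v → P.power v < ((N v / 2 : ℕ) : ℤ) →
      ∃ P', D.step (some P) (posLetter Γ N v) = some P' ∧ P.IsMove v (P.power v + 1) P'
  /-- the other transitions along `v` -/
  step_pos_reject : ∀ (P : PoweredClique Γ N) (v : V),
    ¬ (0 ≤ P.power v ∧ P.power v < ((N v / 2 : ℕ) : ℤ)) →
      D.step (some P) (posLetter Γ N v) = none
  /-- a transition along `v⁻¹` that lowers the power at `v`; for `N v = 2` the letter `v⁻¹` is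
  the letter `v`, whose transitions are described above -/
  step_neg : ∀ (P : PoweredClique Γ N) (v : V), N v ≠ 2 →
    -((N v / 2 : ℕ) : ℤ) < P.power v → P.power v ≤ 0 →
      ∃ P', D.step (some P) (negLetter Γ N v) = some P' ∧ P.IsMove v (P.power v - 1) P'
  /-- the other transitions along `v⁻¹` -/
  step_neg_reject : ∀ (P : PoweredClique Γ N) (v : V), N v ≠ 2 →
    ¬ (-((N v / 2 : ℕ) : ℤ) < P.power v ∧ P.power v ≤ 0) →
      D.step (some P) (negLetter Γ N v) = none
  /-- the reject state is never left -/
  step_reject : ∀ s : ↥(ngpStdGens Γ N), D.step none s = none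

/-! Piles supply a lower bound for word length. The pile of a group element is well defined because
syllable multiplication respects the relators. One letter changes a single bead by a unit, so the
total bead size, measured by least absolute residues, grows by at most one per letter
(`length_ofNGP_prod_le`). Neither faithfulness of the action nor a normal form theorem is needed.

On an accepted word the state records the top beads, as integers of absolute value at most `N v /
2`. Each accepted letter moves its bead away from zero, so bead size equals word length
(`top_and_length`), and the word is geodesic.

Conversely, at the first rejected letter the syllable recorded at its vertex can be commuted to the
end (`exists_split`). The letter then either cancels into it or pushes it past half the order, where
going round the other way is no longer than the old syllable. Hence the word shortens
(`exists_shorter`).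

The automaton exists because distinct vertices or signs name the same letter only when `N` is 1, and
there every transition rejects (`next_congr`). -/

/-! ### Piles

A pile has a stack of beads over every vertex. Multiplication by a syllable at `v` changes the bead
on top of the stack at `v`, and puts a zero bead on the stacks of the other vertices that do not
commute with `v`. The group acts on the piles that arise in this way. -/

/-- A stack of residues over every vertex; the head of the list is the top of the stack. -/
abbrev Pile {V : Type*} (N : V → ℕ) : Type _ := ∀ v, List (ZMod (N v))

namespace Pile

variable {V : Type*} {Γ : SimpleGraph V} {N : V → ℕ}

/-- The bead on top of the stack at `v`, and zero if there is none. -/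
def top (p : Pile N) (v : V) : ZMod (N v) := (p v).headD 0

open Classical in
/-- Put a nonzero bead on the stack at `v`, and zero beads on the stacks of all other vertices that
are not adjacent to `v`. -/
noncomputable def push (Γ : SimpleGraph V) (v : V) (a : ZMod (N v)) (p : Pile N) : Pile N :=
  if a = 0 then p else fun u => if Γ.Adj v u then p u else (Pi.single v a : ∀ u, ZMod (N u)) u :: p u

open Classical in
/-- Remove a nonzero bead from the top of the stack at `v`, together with the zero beads that came
with it. -/
noncomputable def pop (Γ : SimpleGraph V) (v : V) (p : Pile N) : Pile N :=
  if p.top v = 0 then p else fun u => if Γ.Adj v u then p u else (p u).tail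

/-- Multiplication by the syllable `v ^ a`. -/
noncomputable def act (Γ : SimpleGraph V) (v : V) (a : ZMod (N v)) (p : Pile N) : Pile N :=
  push Γ v (p.top v + a) (pop Γ v p)

/-- The piles that are built by putting nonzero beads on stacks without a nonzero bead on top. -/
inductive IsReduced (Γ : SimpleGraph V) : Pile N → Prop
  | nil : IsReduced Γ fun _ => []
  | push (v : V) (a : ZMod (N v)) (p : Pile N) :
      IsReduced Γ p → p.top v = 0 → IsReduced Γ (push Γ v a p)

/-! ### Push and pop -/

@[simp]
theorem push_zero (v : V) (p : Pile N) : push Γ v 0 p = p := by simp [push]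

theorem top_push_of_adj {u v : V} (h : Γ.Adj v u) (a : ZMod (N v)) (p : Pile N) :
    (push Γ v a p).top u = p.top u := by
  by_cases ha : a = 0 <;> simp [push, top, ha, h]

theorem top_push_self {v : V} {p : Pile N} (hp : p.top v = 0) (a : ZMod (N v)) :
    (push Γ v a p).top v = a := by
  by_cases ha : a = 0
  · simp [ha, hp]
  · simp [push, top, ha]

theorem top_push_of_not_adj {u v : V} (huv : u ≠ v) (h : ¬ Γ.Adj v u) {a : ZMod (N v)}
    (ha : a ≠ 0) (p : Pile N) : (push Γ v a p).top u = 0 := by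
  classical
  simp [push, top, ha, h, Pi.single_eq_of_ne huv]

theorem pop_push {v : V} {p : Pile N} (hp : p.top v = 0) (a : ZMod (N v)) :
    pop Γ v (push Γ v a p) = p := by
  by_cases ha : a = 0
  · simp [ha, pop, hp]
  · rw [pop, top_push_self hp, if_neg ha]
    funext u
    by_cases h : Γ.Adj v u <;> simp [push, ha, h]

theorem act_push {v : V} {p : Pile N} (hp : p.top v = 0) (a b : ZMod (N v)) :
    act Γ v a (push Γ v b p) = push Γ v (b + a) p := by
  rw [act, pop_push hp, top_push_self hp]

theorem push_comm {u v : V} (h : Γ.Adj u v) (a : ZMod (N u)) (b : ZMod (N v)) (p : Pile N) :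
    push Γ u a (push Γ v b p) = push Γ v b (push Γ u a p) := by
  classical
  by_cases ha : a = 0
  · simp [ha]
  by_cases hb : b = 0
  · simp [hb]
  funext w
  by_cases hu : Γ.Adj u w
  · simp [push, ha, hb, hu]
  by_cases hv : Γ.Adj v w
  · simp [push, ha, hb, hu, hv]
  have hwu : w ≠ u := by rintro rfl; exact hv h.symm
  have hwv : w ≠ v := by rintro rfl; exact hu h
  simp [push, ha, hb, hu, hv, Pi.single_eq_of_ne hwu, Pi.single_eq_of_ne hwv]

/-- A push at a vertex other than `v` and not adjacent to it would hide the bead at `v` under a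
zero. So every nonzero push after a visible bead at `v` is at a neighbour and commutes past it. This
reduces identities for `act` to identities for `push`. -/
theorem IsReduced.exists_eq_push {p : Pile N} (hp : IsReduced Γ p) (v : V) :
    ∃ r, IsReduced Γ r ∧ r.top v = 0 ∧ p = Pile.push Γ v (p.top v) r := by
  by_cases h0 : p.top v = 0
  · exact ⟨p, hp, h0, by simp [h0]⟩
  induction hp with
  | nil => exact absurd rfl h0
  | push u a q hq hqu ih =>
    by_cases ha : a = 0
    · subst ha
      simp only [push_zero] at h0 ⊢
      exact ih h0
    by_cases huv : v = u
    · subst huv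
      exact ⟨q, hq, hqu, by rw [top_push_self hqu]⟩
    by_cases hadj : Γ.Adj u v
    · rw [top_push_of_adj hadj] at h0 ⊢
      obtain ⟨r, hr, hrv, hqr⟩ := ih h0
      refine ⟨Pile.push Γ u a r, hr.push u a r ?_, ?_, ?_⟩
      · rw [hqr, top_push_of_adj hadj.symm] at hqu
        exact hqu
      · rw [top_push_of_adj hadj, hrv]
      · rw [push_comm hadj.symm, ← hqr]
    · exact absurd (top_push_of_not_adj huv hadj ha q) h0

/-! ### The group action on reduced piles -/

theorem IsReduced.act {p : Pile N} (hp : IsReduced Γ p) (v : V) (a : ZMod (N v)) :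
    IsReduced Γ (act Γ v a p) := by
  obtain ⟨r, hr, hrv, hpr⟩ := hp.exists_eq_push v
  rw [hpr, act_push hrv]
  exact hr.push v _ r hrv

theorem IsReduced.act_act {p : Pile N} (hp : IsReduced Γ p) (v : V) (a b : ZMod (N v)) :
    Pile.act Γ v a (Pile.act Γ v b p) = Pile.act Γ v (b + a) p := by
  obtain ⟨r, hr, hrv, hpr⟩ := hp.exists_eq_push v
  rw [hpr, act_push hrv, act_push hrv, act_push hrv, add_assoc]

theorem IsReduced.act_zero {p : Pile N} (hp : IsReduced Γ p) (v : V) :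
    Pile.act Γ v 0 p = p := by
  obtain ⟨r, hr, hrv, hpr⟩ := hp.exists_eq_push v
  conv_lhs => rw [hpr, act_push hrv, add_zero, ← hpr]

theorem IsReduced.act_comm {p : Pile N} (hp : IsReduced Γ p) {u v : V} (h : Γ.Adj u v)
    (a : ZMod (N u)) (b : ZMod (N v)) :
    Pile.act Γ u a (Pile.act Γ v b p) = Pile.act Γ v b (Pile.act Γ u a p) := by
  -- Both beads are lifted off a common pile `s`, where the two pushes commute.
  obtain ⟨r, hr, hrv, hpr⟩ := hp.exists_eq_push v
  obtain ⟨s, hs, hsu, hrs⟩ := hr.exists_eq_push u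
  have hsv : s.top v = 0 := by rwa [hrs, top_push_of_adj h] at hrv
  have hv : ∀ c, (Pile.push Γ u c s).top v = 0 := fun c => by rw [top_push_of_adj h, hsv]
  have hu : ∀ c, (Pile.push Γ v c s).top u = 0 := fun c => by rw [top_push_of_adj h.symm, hsu]
  rw [hpr, hrs, act_push (hv _), ← push_comm h, act_push (hu _), ← push_comm h, act_push (hu _),
    push_comm h, push_comm h, act_push (hv _)]

/-- The reduced piles. -/
abbrev Reduced (Γ : SimpleGraph V) (N : V → ℕ) : Type _ := {p : Pile N // IsReduced Γ p}

/-- Multiplication by a syllable, as a permutation of the reduced piles. -/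
noncomputable def actPerm (Γ : SimpleGraph V) (v : V) (a : ZMod (N v)) :
    Equiv.Perm (Reduced Γ N) where
  toFun p := ⟨act Γ v a p.1, p.2.act v a⟩
  invFun p := ⟨act Γ v (-a) p.1, p.2.act v (-a)⟩
  left_inv p := Subtype.ext <| by simp [p.2.act_act, p.2.act_zero]
  right_inv p := Subtype.ext <| by simp [p.2.act_act, p.2.act_zero]

theorem actPerm_pow (v : V) (a : ZMod (N v)) (n : ℕ) :
    actPerm Γ v a ^ n = actPerm Γ v ((n : ZMod (N v)) * a) := by
  induction n with
  | zero =>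
    ext1 p
    exact Subtype.ext (by simp [actPerm, p.2.act_zero])
  | succ n ih =>
    ext1 p
    rw [pow_succ, ih]
    refine Subtype.ext ?_
    simp [actPerm, p.2.act_act, add_mul, add_comm]

/-- The action of the numbered graph product on reduced piles. A vertex acts by its inverse, since
this is a left action, while piles are read from left to right. -/
noncomputable def actHom (Γ : SimpleGraph V) (N : V → ℕ) : NGP Γ N →* Equiv.Perm (Reduced Γ N) :=
  PresentedGroup.toGroup (f := fun v => actPerm Γ v (-1)) <| by
    rintro r (⟨v, rfl⟩ | ⟨u, v, h, rfl⟩)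
    · rw [map_pow, FreeGroup.lift_apply_of, actPerm_pow, CharP.cast_eq_zero, zero_mul]
      ext1 p
      exact Subtype.ext (by simp [actPerm, p.2.act_zero])
    · simp only [map_mul, map_inv, FreeGroup.lift_apply_of]
      rw [mul_inv_eq_one, mul_inv_eq_iff_eq_mul]
      ext1 p
      exact Subtype.ext (p.2.act_comm h _ _)

/-- The pile of a group element. -/
noncomputable def ofNGP (g : NGP Γ N) : Pile N := (actHom Γ N g⁻¹ ⟨_, .nil⟩).1

theorem isReduced_ofNGP (g : NGP Γ N) : IsReduced Γ (ofNGP g) := (actHom Γ N g⁻¹ ⟨_, .nil⟩).2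

theorem ofNGP_one : ofNGP (1 : NGP Γ N) = fun _ => [] := by simp [ofNGP]

theorem ofNGP_mul (g : NGP Γ N) (v : V) {ε : ℤ} (hε : ε = 1 ∨ ε = -1) :
    ofNGP (g * ngpGen Γ N v ^ ε) = act Γ v ε (ofNGP g) := by
  have h : actHom Γ N (ngpGen Γ N v) = actPerm Γ v (-1) := PresentedGroup.toGroup.of _
  rcases hε with rfl | rfl
  · rw [Int.cast_one, zpow_one, ofNGP, mul_inv_rev, map_mul, map_inv, h]
    change act Γ v (- -1) _ = _
    rw [neg_neg]
    rfl
  · simp [ofNGP, h, actPerm]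

/-! ### Size of a pile -/

/-- The total size of the beads. -/
def length [Fintype V] (p : Pile N) : ℕ :=
  ∑ v, ((p v).map fun a => a.valMinAbs.natAbs).sum

theorem length_push [Fintype V] (v : V) (a : ZMod (N v)) (p : Pile N) :
    (push Γ v a p).length = p.length + a.valMinAbs.natAbs := by
  classical
  by_cases ha : a = 0
  · simp [ha]
  have h : ∀ u, ((push Γ v a p u).map fun a => a.valMinAbs.natAbs).sum =
      ((p u).map fun a => a.valMinAbs.natAbs).sum +
        ((Pi.single v a : ∀ u, ZMod (N u)) u).valMinAbs.natAbs := by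
    intro u
    by_cases hu : Γ.Adj v u
    · simp [push, ha, hu, Pi.single_eq_of_ne hu.ne']
    · simp [push, ha, hu, add_comm]
  rw [length, Finset.sum_congr rfl fun u _ => h u, Finset.sum_add_distrib, length, add_right_inj,
    Finset.sum_eq_single v (fun u _ hu => by simp [Pi.single_eq_of_ne hu]) (by simp),
    Pi.single_eq_same]

/-- Only absolute values agree: for even positive `n` the least residue of `-n/2` is `n/2`. -/
theorem natAbs_valMinAbs_intCast_le {n : ℕ} {k : ℤ} (hk : k.natAbs ≤ n / 2) :
    (k : ZMod n).valMinAbs.natAbs = k.natAbs := by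
  obtain ⟨m, rfl | rfl⟩ := Int.eq_nat_or_neg k
  · simp only [Int.natAbs_natCast] at hk
    simp [ZMod.valMinAbs_natCast_of_le_half hk]
  · simp only [Int.natAbs_neg, Int.natAbs_natCast] at hk
    simp [ZMod.natAbs_valMinAbs_neg, ZMod.valMinAbs_natCast_of_le_half hk]

theorem natAbs_valMinAbs_unit_le {n : ℕ} {ε : ℤ} (hε : ε = 1 ∨ ε = -1) :
    (ε : ZMod n).valMinAbs.natAbs ≤ 1 := by
  have h1 : (1 : ZMod n).valMinAbs.natAbs ≤ 1 := by
    rcases Nat.lt_or_ge n 2 with h | h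
    · interval_cases n <;> decide
    · have := natAbs_valMinAbs_intCast_le (n := n) (k := 1) (by simp; omega)
      simpa using this.le
  rcases hε with rfl | rfl
  · simpa using h1
  · simpa [ZMod.natAbs_valMinAbs_neg] using h1

theorem length_act_le [Fintype V] {p : Pile N} (hp : IsReduced Γ p) (v : V) {ε : ℤ}
    (hε : ε = 1 ∨ ε = -1) : (act Γ v ε p).length ≤ p.length + 1 := by
  obtain ⟨r, hr, hrv, hpr⟩ := hp.exists_eq_push v
  generalize p.top v = b at hpr
  rw [hpr, act_push hrv, length_push, length_push]
  have h1 := ZMod.natAbs_valMinAbs_add_le b (ε : ZMod (N v))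
  have h2 := natAbs_valMinAbs_unit_le (n := N v) hε
  omega

end Pile

section NumberedGraphProduct

variable {V : Type*} {Γ : SimpleGraph V} {N : V → ℕ}

/-! ### Letters -/

theorem ngpGen_pow (v : V) : ngpGen Γ N v ^ N v = 1 := by
  rw [ngpGen, PresentedGroup.of, ← map_pow]
  exact PresentedGroup.one_of_mem (Or.inl ⟨v, rfl⟩)

theorem commute_ngpGen {u v : V} (h : Γ.Adj u v) : Commute (ngpGen Γ N u) (ngpGen Γ N v) := by
  have := PresentedGroup.one_of_mem (rels := ngpRels Γ N)
    (Or.inr ⟨u, v, h, rfl⟩ : FreeGroup.of u * FreeGroup.of v * (FreeGroup.of u)⁻¹ *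
      (FreeGroup.of v)⁻¹ ∈ ngpRels Γ N)
  simp only [map_mul, map_inv] at this
  rwa [mul_inv_eq_one, mul_inv_eq_iff_eq_mul] at this

/-- `IsSign N v ε` says that `ε` is the exponent of a letter at `v`, where `v⁻¹` is not counted
as a letter of its own when `N v = 2`. -/
def IsSign (N : V → ℕ) (v : V) (ε : ℤ) : Prop := (ε = 1 ∨ ε = -1) ∧ (N v = 2 → ε = 1)

theorem exists_letter_eq (s : ↥(ngpStdGens Γ N)) :
    ∃ v ε, IsSign N v ε ∧ (s : NGP Γ N) = ngpGen Γ N v ^ ε := by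
  obtain ⟨s, ⟨v, rfl⟩ | ⟨v, rfl⟩⟩ := s
  · exact ⟨v, 1, ⟨by simp, by simp⟩, by simp⟩
  · by_cases h : N v = 2
    · refine ⟨v, 1, ⟨by simp, by simp⟩, ?_⟩
      have := ngpGen_pow (Γ := Γ) (N := N) v
      rw [h, pow_two] at this
      simp [inv_eq_of_mul_eq_one_left this]
    · exact ⟨v, -1, ⟨by simp, by simp [h]⟩, by simp⟩

theorem ofNGP_zpow (v : V) {ε : ℤ} (hε : ε = 1 ∨ ε = -1) :
    Pile.ofNGP (ngpGen Γ N v ^ ε) = Pile.push Γ v ε fun _ => [] := by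
  have h : Pile.top (N := N) (fun _ => []) v = 0 := rfl
  rw [← one_mul (ngpGen Γ N v ^ ε), Pile.ofNGP_mul 1 v hε, Pile.ofNGP_one]
  conv_lhs => rw [← Pile.push_zero (Γ := Γ) v fun _ => [], Pile.act_push h, zero_add]

theorem eq_one_of_intCast_eq_zero {n : ℕ} {ε : ℤ} (hε : ε = 1 ∨ ε = -1) (h : (ε : ZMod n) = 0) :
    n = 1 := by
  rw [ZMod.intCast_zmod_eq_zero_iff_dvd] at h
  have := Int.natAbs_dvd_natAbs.2 h
  rcases hε with rfl | rfl <;> simpa using this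

/-- The piles of the two letters have top beads `ε` and `0` at `v`, so a unit vanishes modulo `N v`.
-/
theorem eq_one_of_zpow_eq {u v : V} (huv : u ≠ v) {ε η : ℤ} (hε : ε = 1 ∨ ε = -1)
    (hη : η = 1 ∨ η = -1) (h : ngpGen Γ N v ^ ε = ngpGen Γ N u ^ η) : N v = 1 := by
  by_cases h0 : (η : ZMod (N u)) = 0
  · refine eq_one_of_intCast_eq_zero hε ?_
    have := congrArg (fun g => (Pile.ofNGP g).top v) h
    simp only [ofNGP_zpow _ hε, ofNGP_zpow _ hη, h0, Pile.push_zero] at this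
    rwa [Pile.top_push_self rfl] at this
  · refine eq_one_of_intCast_eq_zero hε ?_
    have := congrArg (fun g => (Pile.ofNGP g).top v) h
    simp only [ofNGP_zpow _ hε, ofNGP_zpow _ hη] at this
    rw [Pile.top_push_self rfl] at this
    rw [this]
    by_cases hadj : Γ.Adj u v
    · exact Pile.top_push_of_adj hadj _ _
    · exact Pile.top_push_of_not_adj huv.symm hadj h0 _

theorem eq_or_eq_one_of_zpow_eq {u v : V} {ε η : ℤ} (hε : IsSign N v ε) (hη : IsSign N u η)
    (h : ngpGen Γ N v ^ ε = ngpGen Γ N u ^ η) :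
    (v = u ∧ ε = η) ∨ (N v = 1 ∧ N u = 1) := by
  by_cases huv : u = v
  · subst huv
    have := congrArg (fun g => (Pile.ofNGP g).top u) h
    simp only [ofNGP_zpow _ hε.1, ofNGP_zpow _ hη.1] at this
    rw [Pile.top_push_self rfl, Pile.top_push_self rfl, ZMod.intCast_eq_intCast_iff_dvd_sub] at this
    by_cases he : ε = η
    · exact Or.inl ⟨rfl, he⟩
    have hdvd : N u ∣ 2 := by
      rcases hε.1 with rfl | rfl <;> rcases hη.1 with rfl | rfl
      · exact absurd rfl he
      · exact Int.natCast_dvd_natCast.1 (by simpa using this)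
      · exact Int.natCast_dvd_natCast.1 (by simpa using this)
      · exact absurd rfl he
    rcases (Nat.dvd_prime Nat.prime_two).1 hdvd with h1 | h2
    · exact Or.inr ⟨h1, h1⟩
    · exact absurd ((hε.2 h2).trans (hη.2 h2).symm) he
  · exact Or.inr ⟨eq_one_of_zpow_eq huv hε.1 hη.1 h,
      eq_one_of_zpow_eq (Ne.symm huv) hη.1 hε.1 h.symm⟩

theorem exists_word_zpow (v : V) (k : ℤ) : ∃ y : List ↥(ngpStdGens Γ N),
    (y.map Subtype.val).prod = ngpGen Γ N v ^ k ∧ y.length = k.natAbs := by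
  rcases Int.natAbs_eq k with h | h
  · exact ⟨List.replicate k.natAbs (posLetter Γ N v), by
      rw [List.map_replicate, List.prod_replicate, ← zpow_natCast, ← h]; rfl, by simp⟩
  · exact ⟨List.replicate k.natAbs (negLetter Γ N v), by
      rw [List.map_replicate, List.prod_replicate, ← zpow_natCast]
      conv_rhs => rw [h]
      simp [negLetter], by simp⟩

theorem length_ofNGP_prod_le [Fintype V] (y : List ↥(ngpStdGens Γ N)) :
    (Pile.ofNGP (y.map Subtype.val).prod).length ≤ y.length := by
  induction y using List.reverseRecOn with
  | nil => simp [Pile.ofNGP_one, Pile.length]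
  | append_singleton y s ih =>
    obtain ⟨v, ε, hε, hs⟩ := exists_letter_eq s
    have := Pile.length_act_le (Pile.isReduced_ofNGP (y.map Subtype.val).prod) v hε.1
    simp only [List.map_append, List.map_cons, List.map_nil, List.prod_append, List.prod_singleton,
      List.length_append, List.length_singleton, hs, Pile.ofNGP_mul _ _ hε.1]
    omega

/-! ### The automaton -/

namespace PoweredClique

theorem natAbs_power_le (P : PoweredClique Γ N) (v : V) : (P.power v).natAbs ≤ N v / 2 := by
  by_cases h : N v = 2
  · have := P.bounds_of_eq_two v h
    omega
  · have := P.bounds_of_ne_two v h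
    omega

instance [Finite V] : Finite (PoweredClique Γ N) := by
  refine Finite.of_injective (β := ∀ v, Set.Icc (-((N v / 2 : ℕ) : ℤ)) ((N v / 2 : ℕ) : ℤ))
    (fun P v => ⟨P.power v, by have := P.natAbs_power_le v; constructor <;> omega⟩) ?_
  intro P Q h
  ext v
  exact congrArg Subtype.val (congrFun h v)

theorem IsMove.power_eq_zero {P Q : PoweredClique Γ N} {v : V} {k : ℤ} (h : P.IsMove v k Q) {u : V}
    (huv : u ≠ v) (hu : ¬ Γ.Adj v u) : Q.power u = 0 := by
  by_contra h0
  have : u ∈ Q.supp := h0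
  rw [h.supp_eq] at this
  rcases this with this | this
  · exact hu this.2
  · exact huv this

theorem IsMove.unique {P Q R : PoweredClique Γ N} {v : V} {k : ℤ} (hQ : P.IsMove v k Q)
    (hR : P.IsMove v k R) : Q = R := by
  ext u
  by_cases huv : u = v
  · rw [huv, hQ.power_self, hR.power_self]
  by_cases hu : Γ.Adj v u
  · rw [hQ.power_of_mem_link u hu, hR.power_of_mem_link u hu]
  · rw [hQ.power_eq_zero huv hu, hR.power_eq_zero huv hu]

/-- The letter `v ^ ε` may follow the powered clique `P`. -/
def CanFollow (P : PoweredClique Γ N) (v : V) (ε : ℤ) : Prop :=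
  0 ≤ ε * P.power v ∧ ε * P.power v < ((N v / 2 : ℕ) : ℤ)

theorem exists_isMove (P : PoweredClique Γ N) {v : V} {ε : ℤ} (hε : IsSign N v ε)
    (h : P.CanFollow v ε) : ∃ Q, P.IsMove v (P.power v + ε) Q := by
  classical
  obtain ⟨h0, h1⟩ := h
  obtain ⟨hs, h2⟩ := hε
  refine ⟨⟨fun u => if u = v then P.power v + ε else if Γ.Adj v u then P.power u else 0,
    ?_, ?_, ?_⟩, ?_, ?_, ?_⟩
  · intro u hu w hw huw
    simp only [Set.mem_ofPred_eq] at hu hw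
    by_cases huv : u = v
    · subst huv
      by_contra hn
      simp [huw.symm, hn] at hw
    by_cases hwv : w = v
    · subst hwv
      by_contra hn
      rw [Γ.adj_comm] at hn
      simp [huw, hn] at hu
    by_cases hau : Γ.Adj v u
    · by_cases haw : Γ.Adj v w
      · simp only [huv, hwv, hau, haw, if_true, if_false] at hu hw
        exact P.isClique_support hu hw huw
      · simp [hwv, haw] at hw
    · simp [huv, hau] at hu
  · intro u hu
    have := P.bounds_of_eq_two u hu
    split_ifs with huv
    · subst huv
      obtain rfl := h2 hu
      rw [hu] at h1
      norm_num at h0 h1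
      omega
    · exact this
    · simp
  · intro u hu
    have := P.bounds_of_ne_two u hu
    split_ifs with huv
    · subst huv
      rcases hs with rfl | rfl <;> omega
    · exact this
    · omega
  · have : P.power v + ε ≠ 0 := by rcases hs with rfl | rfl <;> omega
    ext u
    by_cases huv : u = v
    · simp [supp, huv, this]
    · by_cases hau : Γ.Adj v u <;> simp [supp, huv, hau]
  · intro u hu
    have : u ≠ v := fun h => Γ.loopless.irrefl v (h ▸ hu)
    simp [this, (Γ.mem_neighborSet v u).1 hu]
  · simp

open Classical in
/-- The transition from `P` along the letter `v ^ ε`. -/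
noncomputable def next (P : PoweredClique Γ N) (v : V) (ε : ℤ) : Option (PoweredClique Γ N) :=
  if h : IsSign N v ε ∧ P.CanFollow v ε then some (P.exists_isMove h.1 h.2).choose else none

theorem next_eq_some_iff {P Q : PoweredClique Γ N} {v : V} {ε : ℤ} (hε : IsSign N v ε) :
    P.next v ε = some Q ↔ P.CanFollow v ε ∧ P.IsMove v (P.power v + ε) Q := by
  unfold next
  by_cases h : P.CanFollow v ε
  · have hs := (P.exists_isMove hε h).choose_spec
    rw [dif_pos ⟨hε, h⟩, Option.some_inj]
    exact ⟨fun e => ⟨h, e ▸ hs⟩, fun e => hs.unique e.2⟩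
  · simp [h]

theorem next_eq_none_iff {P : PoweredClique Γ N} {v : V} {ε : ℤ} (hε : IsSign N v ε) :
    P.next v ε = none ↔ ¬ P.CanFollow v ε := by
  simp [next, hε]

/-- Letters are group elements, so transitions must not depend on how a letter is written. Different
spellings force `N = 1`, where `N / 2 = 0` leaves no room for a move. -/
theorem next_congr (P : PoweredClique Γ N) {u v : V} {ε η : ℤ} (hε : IsSign N v ε)
    (hη : IsSign N u η) (h : ngpGen Γ N v ^ ε = ngpGen Γ N u ^ η) : P.next v ε = P.next u η := by
  rcases eq_or_eq_one_of_zpow_eq hε hη h with ⟨rfl, rfl⟩ | ⟨hv, hu⟩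
  · rfl
  · rw [(next_eq_none_iff hε).2, (next_eq_none_iff hη).2]
    · rintro ⟨h0, h1⟩
      simp only [hu] at h1
      omega
    · rintro ⟨h0, h1⟩
      simp only [hv] at h1
      omega

end PoweredClique

open PoweredClique

theorem isSign_one (v : V) : IsSign N v 1 := ⟨Or.inl rfl, fun _ => rfl⟩

theorem isSign_neg_one {v : V} (h : N v ≠ 2) : IsSign N v (-1) := ⟨Or.inr rfl, fun e => absurd e h⟩

theorem IsPoweredCliqueAutomaton.step_eq {D : DFA ↥(ngpStdGens Γ N) (Option (PoweredClique Γ N))}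
    (hD : IsPoweredCliqueAutomaton Γ N D) (P : PoweredClique Γ N) {s : ↥(ngpStdGens Γ N)} {v : V}
    {ε : ℤ} (hε : IsSign N v ε) (hs : (s : NGP Γ N) = ngpGen Γ N v ^ ε) :
    D.step (some P) s = P.next v ε := by
  obtain ⟨rfl | rfl, h2⟩ := hε
  · obtain rfl : s = posLetter Γ N v := Subtype.ext (by simpa [posLetter] using hs)
    by_cases h : P.CanFollow v 1
    · obtain ⟨Q, hQ, hm⟩ := hD.step_pos P v (by simpa using h.1) (by simpa using h.2)
      rw [hQ, eq_comm, next_eq_some_iff (isSign_one v)]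
      exact ⟨h, hm⟩
    · rw [(next_eq_none_iff (isSign_one v)).2 h]
      exact hD.step_pos_reject P v (by simpa [CanFollow] using h)
  · have h2 : N v ≠ 2 := fun e => by simpa using h2 e
    obtain rfl : s = negLetter Γ N v := Subtype.ext (by simpa [negLetter] using hs)
    by_cases h : P.CanFollow v (-1)
    · obtain ⟨h0, h1⟩ := id h
      obtain ⟨Q, hQ, hm⟩ := hD.step_neg P v h2 (by omega) (by omega)
      rw [hQ, eq_comm, next_eq_some_iff (isSign_neg_one h2)]
      exact ⟨h, hm⟩
    · rw [(next_eq_none_iff (isSign_neg_one h2)).2 h]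
      refine hD.step_neg_reject P v h2 fun h' => h ⟨?_, ?_⟩ <;> omega

theorem existsUnique_isPoweredCliqueAutomaton (Γ : SimpleGraph V) (N : V → ℕ) :
    ∃! D : DFA ↥(ngpStdGens Γ N) (Option (PoweredClique Γ N)), IsPoweredCliqueAutomaton Γ N D := by
  choose v ε hε hs using exists_letter_eq (Γ := Γ) (N := N)
  let D : DFA ↥(ngpStdGens Γ N) (Option (PoweredClique Γ N)) :=
    { step := fun q s => q.bind fun P => P.next (v s) (ε s)
      start := some (PoweredClique.empty Γ N)
      accept := Set.range some }
  have hp : ∀ P w, D.step (some P) (posLetter Γ N w) = P.next w 1 := fun P w =>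
    P.next_congr (hε _) (isSign_one w) (by rw [← hs, zpow_one]; rfl)
  have hn : ∀ P w, N w ≠ 2 → D.step (some P) (negLetter Γ N w) = P.next w (-1) := fun P w hw =>
    P.next_congr (hε _) (isSign_neg_one hw) (by rw [← hs, zpow_neg_one]; rfl)
  refine ⟨D, ⟨rfl, rfl, ?_, ?_, ?_, ?_, fun _ => rfl⟩, ?_⟩
  · intro P w h0 h1
    have hc : P.CanFollow w 1 := ⟨by simpa using h0, by simpa using h1⟩
    obtain ⟨Q, hQ⟩ := P.exists_isMove (isSign_one w) hc
    exact ⟨Q, by rw [hp, next_eq_some_iff (isSign_one w)]; exact ⟨hc, hQ⟩, hQ⟩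
  · intro P w h
    rw [hp, next_eq_none_iff (isSign_one w)]
    simpa [CanFollow] using h
  · intro P w hw h0 h1
    have hc : P.CanFollow w (-1) := ⟨by omega, by omega⟩
    obtain ⟨Q, hQ⟩ := P.exists_isMove (isSign_neg_one hw) hc
    exact ⟨Q, by rw [hn _ _ hw, next_eq_some_iff (isSign_neg_one hw)]; exact ⟨hc, hQ⟩, hQ⟩
  · intro P w hw h
    rw [hn _ _ hw, next_eq_none_iff (isSign_neg_one hw)]
    rintro ⟨h0, h1⟩
    exact h ⟨by omega, by omega⟩
  · intro E hE
    have hstep : E.step = D.step := by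
      funext q s
      cases q with
      | none => exact hE.step_reject s
      | some P => exact hE.step_eq P (hε s) (hs s)
    obtain ⟨_, _, _⟩ := E
    exact (DFA.mk.injEq ..).mpr ⟨hstep, hE.start_eq, hE.accept_eq⟩

/-! ### The accepted language -/

section Language

variable {D : DFA ↥(ngpStdGens Γ N) (Option (PoweredClique Γ N))}

theorem IsPoweredCliqueAutomaton.exists_eval_of_eval_append
    (hD : IsPoweredCliqueAutomaton Γ N D) {x : List ↥(ngpStdGens Γ N)} {s : ↥(ngpStdGens Γ N)}
    {Q : PoweredClique Γ N} {v : V} {ε : ℤ} (hε : IsSign N v ε)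
    (hs : (s : NGP Γ N) = ngpGen Γ N v ^ ε) (h : D.eval (x ++ [s]) = some Q) :
    ∃ P, D.eval x = some P ∧ P.CanFollow v ε ∧ P.IsMove v (P.power v + ε) Q := by
  rw [DFA.eval_append_singleton] at h
  cases hx : D.eval x with
  | none => simp [hx, hD.step_reject] at h
  | some P =>
    rw [hx, hD.step_eq P hε hs, next_eq_some_iff hε] at h
    exact ⟨P, rfl, h⟩

/-- The powers of the state are the beads on top of the pile of an accepted word, and the length of
this pile is the length of the word. -/
theorem IsPoweredCliqueAutomaton.top_and_length [Fintype V] (hD : IsPoweredCliqueAutomaton Γ N D)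
    {x : List ↥(ngpStdGens Γ N)} {P : PoweredClique Γ N} (hx : D.eval x = some P) :
    (∀ v, (Pile.ofNGP (x.map Subtype.val).prod).top v = P.power v) ∧
      (Pile.ofNGP (x.map Subtype.val).prod).length = x.length := by
  induction x using List.reverseRecOn generalizing P with
  | nil =>
    rw [DFA.eval_nil, hD.start_eq, Option.some_inj] at hx
    subst hx
    simp [Pile.ofNGP_one, Pile.length, Pile.top, PoweredClique.empty]
  | append_singleton x s ih =>
    obtain ⟨v, ε, hε, hs⟩ := exists_letter_eq s
    obtain ⟨Q, hQ, ⟨hc0, hc1⟩, hm⟩ := hD.exists_eval_of_eval_append hε hs hx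
    obtain ⟨htop, hlen⟩ := ih hQ
    obtain ⟨r, hr, hrv, hpr⟩ := (Pile.isReduced_ofNGP (x.map Subtype.val).prod).exists_eq_push v
    rw [htop] at hpr
    have hnew : (Pile.ofNGP ((x ++ [s]).map Subtype.val).prod) =
        Pile.push Γ v ((Q.power v + ε : ℤ) : ZMod (N v)) r := by
      simp only [List.map_append, List.map_cons, List.map_nil, List.prod_append,
        List.prod_singleton, hs, Pile.ofNGP_mul _ _ hε.1]
      rw [hpr, Pile.act_push hrv, Int.cast_add]
    -- An accepted letter never points towards zero, so nothing cancels.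
    have habs : (Q.power v + ε).natAbs = (Q.power v).natAbs + 1 := by
      rcases hε.1 with rfl | rfl <;> omega
    have hle : (Q.power v + ε).natAbs ≤ N v / 2 := by
      rw [← hm.power_self]
      exact P.natAbs_power_le v
    have hsize := Pile.natAbs_valMinAbs_intCast_le hle
    rw [hnew]
    constructor
    · intro u
      by_cases huv : u = v
      · subst huv
        rw [Pile.top_push_self hrv, hm.power_self]
      by_cases hu : Γ.Adj v u
      · rw [Pile.top_push_of_adj hu, hm.power_of_mem_link u hu, ← htop, hpr,
          Pile.top_push_of_adj hu]
      · rw [Pile.top_push_of_not_adj huv hu, hm.power_eq_zero huv hu, Int.cast_zero]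
        -- The new bead has size at least one, so it really covers the stack at `u`.
        intro h0
        rw [h0] at hsize
        simp at hsize
        omega
    · rw [hpr, Pile.length_push, Pile.natAbs_valMinAbs_intCast_le (Q.natAbs_power_le v)] at hlen
      rw [Pile.length_push, hsize, List.length_append, List.length_singleton]
      omega

/-- The syllable at `v` that the state records can be split off from the end of a word. -/
theorem IsPoweredCliqueAutomaton.exists_split (hD : IsPoweredCliqueAutomaton Γ N D)
    {x : List ↥(ngpStdGens Γ N)} {P : PoweredClique Γ N} (hx : D.eval x = some P) (u : V) :
    ∃ y : List ↥(ngpStdGens Γ N), y.length + (P.power u).natAbs = x.length ∧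
      (y.map Subtype.val).prod * ngpGen Γ N u ^ P.power u = (x.map Subtype.val).prod := by
  induction x using List.reverseRecOn generalizing P with
  | nil =>
    rw [DFA.eval_nil, hD.start_eq, Option.some_inj] at hx
    subst hx
    exact ⟨[], by simp [PoweredClique.empty]⟩
  | append_singleton x s ih =>
    obtain ⟨v, ε, hε, hs⟩ := exists_letter_eq s
    obtain ⟨Q, hQ, ⟨hc0, hc1⟩, hm⟩ := hD.exists_eval_of_eval_append hε hs hx
    obtain ⟨y, hy, hprod⟩ := ih hQ
    by_cases huv : u = v
    · subst huv
      refine ⟨y, ?_, ?_⟩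
      · rw [hm.power_self, List.length_append, List.length_singleton]
        rcases hε.1 with rfl | rfl <;> omega
      · rw [hm.power_self, zpow_add, ← mul_assoc, hprod]
        simp [hs]
    -- A letter at a neighbour commutes past the syllable at `u`; at any other vertex it resets the
    -- recorded power to zero, leaving nothing to split off.
    by_cases hu : Γ.Adj v u
    · refine ⟨y ++ [s], ?_, ?_⟩
      · rw [hm.power_of_mem_link u hu, List.length_append, List.length_append]
        omega
      · have hc := (commute_ngpGen (N := N) hu).zpow_zpow ε (Q.power u)
        simp only [List.map_append, List.map_cons, List.map_nil, List.prod_append,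
          List.prod_singleton, hs, hm.power_of_mem_link u hu, ← hprod]
        rw [mul_assoc, hc.eq, mul_assoc]
    · exact ⟨x ++ [s], by simp [hm.power_eq_zero huv hu]⟩

/-- A rejected word can be shortened. -/
theorem IsPoweredCliqueAutomaton.exists_shorter (hN : ∀ v, 1 ≤ N v)
    (hD : IsPoweredCliqueAutomaton Γ N D) {x : List ↥(ngpStdGens Γ N)} (hx : D.eval x = none) :
    ∃ y : List ↥(ngpStdGens Γ N),
      (y.map Subtype.val).prod = (x.map Subtype.val).prod ∧ y.length < x.length := by
  induction x using List.reverseRecOn with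
  | nil => simp [DFA.eval_nil, hD.start_eq] at hx
  | append_singleton x s ih =>
    cases hP : D.eval x with
    | none =>
      obtain ⟨y, hy, hlen⟩ := ih hP
      exact ⟨y ++ [s], by simp only [List.map_append, List.prod_append, hy], by simpa using hlen⟩
    | some P =>
      obtain ⟨v, ε, hε, hs⟩ := exists_letter_eq s
      rw [DFA.eval_append_singleton, hP, hD.step_eq P hε hs, next_eq_none_iff hε] at hx
      obtain ⟨y, hy, hprod⟩ := hD.exists_split hP v
      -- If the signs are opposite, the letter cancels. Otherwise the power already has size `N v /
      -- 2`, and subtracting `ε * N v` leaves size `N v - N v / 2 - 1`, at most `N v / 2`; this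
      -- needs `1 ≤ N v`.
      have hpow : ∃ k : ℤ, ngpGen Γ N v ^ k = ngpGen Γ N v ^ (P.power v + ε) ∧
          k.natAbs ≤ (P.power v).natAbs := by
        have hb := P.natAbs_power_le v
        have h1 := hN v
        have hz : ngpGen Γ N v ^ (N v : ℤ) = 1 := by rw [zpow_natCast, ngpGen_pow]
        unfold CanFollow at hx
        rcases lt_or_ge (ε * P.power v) 0 with hneg | hpos
        · refine ⟨P.power v + ε, rfl, ?_⟩
          rcases hε.1 with rfl | rfl <;> omega
        · refine ⟨P.power v + ε - ε * N v, ?_, ?_⟩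
          · rw [zpow_sub, mul_comm ε, zpow_mul, hz, one_zpow, inv_one, mul_one]
          · rcases hε.1 with rfl | rfl <;> omega
      obtain ⟨k, hk, hkle⟩ := hpow
      obtain ⟨z, hz, hzlen⟩ := exists_word_zpow (Γ := Γ) (N := N) v k
      refine ⟨y ++ z, ?_, ?_⟩
      · simp only [List.map_append, List.prod_append, List.map_cons, List.map_nil,
          List.prod_singleton]
        rw [hz, hk, zpow_add, ← mul_assoc, hprod, hs]
      · simp only [List.length_append, List.length_singleton]
        omega

theorem IsPoweredCliqueAutomaton.accepts_eq [Finite V] (hN : ∀ v, 1 ≤ N v)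
    (hD : IsPoweredCliqueAutomaton Γ N D) : D.accepts = geodesicLanguage (ngpStdGens Γ N) := by
  have := Fintype.ofFinite V
  ext x
  rw [DFA.mem_accepts, hD.accept_eq]
  constructor
  · rintro ⟨P, hP⟩ y hy
    rw [← (hD.top_and_length hP.symm).2, ← hy]
    exact length_ofNGP_prod_le y
  · intro hx
    cases hP : D.eval x with
    | none =>
      obtain ⟨y, hy, hlen⟩ := hD.exists_shorter hN hP
      exact absurd (hx y hy) hlen.not_ge
    | some P => exact ⟨P, rfl⟩

end Language

end NumberedGraphProduct

theorem theorem4p9 {V : Type*} [Finite V] (Γ : SimpleGraph V) (N : V → ℕ)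
    (hN : ∀ v, 1 ≤ N v) :
    Finite ↥(ngpStdGens Γ N) ∧
    Finite (Option (PoweredClique Γ N)) ∧
    (∃! D : DFA ↥(ngpStdGens Γ N) (Option (PoweredClique Γ N)),
      IsPoweredCliqueAutomaton Γ N D) ∧
    ∀ D : DFA ↥(ngpStdGens Γ N) (Option (PoweredClique Γ N)),
      IsPoweredCliqueAutomaton Γ N D → D.accepts = geodesicLanguage (ngpStdGens Γ N) :=
  ⟨((Set.finite_range _).union (Set.finite_range _)).to_subtype, inferInstance,
    existsUnique_isPoweredCliqueAutomaton Γ N, fun _ hD => hD.accepts_eq hN⟩
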